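/- Let $X$ be a finite set and $H\le \mathrm{Sym}(X)$. If $X=\bigsqcup_k Y_k$ is a partition into non-empty blocks and $H_k\le\mathrm{Sym}(Y_k)$, where $\mathrm{Sym}(Y_k)$ is regarded as the subgroup of $\mathrm{Sym}(X)$ fixing $X\setminus Y_k$ pointwise, write $H=\prod_k H_k$ if $H$ is the internal direct product of the $H_k$. Among all partitions of $X$ for which $H$ can be written as such a product there is a finest one; $H$ is called connected if $X$ is non-empty and this finest partition is $\{X\}$. If $|Y|=i$, the $S_i$-class of a subgroup of $\mathrm{Sym}(Y)$ is the conjugacy class of subgroups of $S_i$ obtained from any bijection $Y\to\{1,\dots,i\}$. (1) For every $n\ge 0$ there is a bijection from the set of conjugacy classes of subgroups of $S_n$ to the set of pairs $(\lambda,(C_1,\dots,C_n))$, where $\lambda=1^{a_1}2^{a_2}\cdots n^{a_n}$ is a partition of $n$ and, for $1\le i\le n$, $C_i$ is a multiset of $a_i$ conjugacy classes of connected subgroups of $S_i$. It sends the class of $H\le S_n$ to the following pair: let $\{Y_k\}$ be the finest partition of $\{1,\dots,n\}$ with $H=\prod_k H_k$, $H_k\le\mathrm{Sym}(Y_k)$;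 then each $H_k$ is connected, $\lambda$ is the partition of $n$ with parts $|Y_k|$, and $C_i$ is the multiset of $S_i$-classes of those $H_k$ with $|Y_k|=i$. (2) Let $m_n$ be the number of conjugacy classes of subgroups of $S_n$ (OEIS A000638) and $c_k$ the number of conjugacy classes of connected subgroups of $S_k$ (OEIS A005226). Then $(m_n)_{n\ge1}$ is the Euler transform of $(c_k)_{k\ge1}$, that is, as formal power series, $$1+\sum_{n\ge1} m_n x^n=\prod_{k\ge1}\left(\frac{1}{1-x^k}\right)^{c_k}.$$ -/

import Mathlib

open scoped Pointwise

/-- `H ≤ Sym(X)` is the product `∏ K Y` over the blocks `Y` of the partition `P` of `X`, where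
`K Y ≤ Sym(Y)` is regarded as a subgroup of `Sym(X)` fixing all points outside `Y`.
(Subgroups supported on disjoint blocks commute and meet trivially, so the subgroup generated by
the factors is their internal direct product.) -/
def IsBlockProduct {X : Type*} [Fintype X] [DecidableEq X] (H : Subgroup (Equiv.Perm X))
    (P : Finpartition (Finset.univ : Finset X))
    (K : ∀ Y : P.parts, Subgroup (Equiv.Perm Y.1)) : Prop :=
  H = ⨆ Y : P.parts, (K Y).map (Equiv.Perm.ofSubtype (p := fun x => x ∈ Y.1))

/-- `P` is the finest partition of `X` along which `H` is a product. In `Finpartition`,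
`P ≤ Q` means that `P` refines `Q`. -/
def IsFinestPartition {X : Type*} [Fintype X] [DecidableEq X] (H : Subgroup (Equiv.Perm X))
    (P : Finpartition (Finset.univ : Finset X)) : Prop :=
  IsLeast {Q | ∃ K, IsBlockProduct H Q K} P

/-- `H ≤ Sym(X)` is connected if its finest partition has `X` as its only block. -/
def IsConnectedSubgroup {X : Type*} [Fintype X] [DecidableEq X]
    (H : Subgroup (Equiv.Perm X)) : Prop :=
  ∃ P, IsFinestPartition H P ∧ P.parts = {Finset.univ}

/-- Conjugacy classes of subgroups of `S_n`: orbits of `S_n` acting on its subgroups by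
conjugation. -/
abbrev SubgroupConjClass (n : ℕ) : Type :=
  MulAction.orbitRel.Quotient (ConjAct (Equiv.Perm (Fin n))) (Subgroup (Equiv.Perm (Fin n)))

/-- The conjugacy class of a subgroup of `S_n`. -/
def subgroupConjClass {n : ℕ} (H : Subgroup (Equiv.Perm (Fin n))) : SubgroupConjClass n :=
  Quotient.mk _ H

/-- Conjugacy classes of connected subgroups of `S_n`. -/
abbrev ConnectedClass (n : ℕ) : Type :=
  {c : SubgroupConjClass n // ∃ H, IsConnectedSubgroup H ∧ subgroupConjClass H = c}

/-- The `S_i`-class of a subgroup of `Sym(Y)` where `|Y| = i`, obtained by numbering the elements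
of `Y`; the numbering is irrelevant by `classOn_eq`. -/
noncomputable def classOn {Y : Type*} [Fintype Y] {i : ℕ} (h : Fintype.card Y = i)
    (K : Subgroup (Equiv.Perm Y)) : SubgroupConjClass i :=
  subgroupConjClass (K.map (Fintype.equivFinOfCardEq h).permCongrHom.toMonoidHom)

theorem classOn_eq {Y : Type*} [Fintype Y] {i : ℕ} (h : Fintype.card Y = i)
    (K : Subgroup (Equiv.Perm Y)) (e : Y ≃ Fin i) :
    classOn h K = subgroupConjClass (K.map e.permCongrHom.toMonoidHom) := by
  refine Quotient.sound ?_
  refine ⟨ConjAct.toConjAct (e.symm.trans (Fintype.equivFinOfCardEq h)), ?_⟩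
  ext σ
  simp only [Subgroup.mem_smul_pointwise_iff_exists, Subgroup.mem_map]
  constructor
  · rintro ⟨_, ⟨τ, hτ, rfl⟩, rfl⟩
    refine ⟨τ, hτ, ?_⟩
    ext x
    simp [ConjAct.toConjAct_smul, Equiv.permCongrHom, Equiv.Perm.inv_def]
  · rintro ⟨τ, hτ, rfl⟩
    refine ⟨_, ⟨τ, hτ, rfl⟩, ?_⟩
    ext x
    simp [ConjAct.toConjAct_smul, Equiv.permCongrHom, Equiv.Perm.inv_def]

/-- Pairs `(λ, (C_1, …, C_n))` where `λ = 1^{a_1} … n^{a_n}` is a partition of `n` and `C_i` is a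
multiset of `a_i` conjugacy classes of connected subgroups of `S_i`. -/
structure PartitionPair (n : ℕ) : Type where
  shape : n.Partition
  classes : ∀ i : Finset.Icc 1 n, Sym (ConnectedClass i) (shape.parts.count (i : ℕ))

/-- The multiset of `S_i`-classes of the factors `K Y` with `|Y| = i`. -/
noncomputable def factorClasses {X : Type*} [Fintype X] [DecidableEq X]
    (P : Finpartition (Finset.univ : Finset X))
    (K : ∀ Y : P.parts, Subgroup (Equiv.Perm Y.1)) (i : ℕ) : Multiset (SubgroupConjClass i) :=
  (Finset.univ : Finset {Y : P.parts // Fintype.card Y.1 = i}).val.map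
    fun Y => classOn Y.2 (K Y.1)

open scoped PowerSeries.WithPiTopology in
/-- `(m_1, m_2, …)` is the Euler transform of `(c_1, c_2, …)`:
`1 + ∑_{n ≥ 1} m_n x^n = ∏_{k ≥ 1} (1 / (1 - x^k))^{c_k}` as formal power series over `ℤ`, the
infinite product converging coefficientwise. The values `m 0` and `c 0` play no role. -/
def IsEulerTransform (m c : ℕ → ℕ) : Prop :=
  HasProd (fun k : ℕ+ =>
      (PowerSeries.invOfUnit (1 - PowerSeries.X ^ (k : ℕ) : PowerSeries ℤ) 1) ^ c k)
    (1 + PowerSeries.mk fun n => if n = 0 then 0 else (m n : ℤ))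

set_option linter.unusedSectionVars false

/-! Say that `H` splits along `S` if the part of each `h ∈ H` on `S`, extended by the identity, is
again in `H`. Such sets are closed under complement and intersection, so they form a Boolean
algebra, and `H` is a product along a partition exactly when it splits along every block. The atoms
therefore form the finest partition (`isFinestPartition_finest`), and for non-empty `X`
connectedness means that only `∅` and `X` split. The blocks of the finest partition are the
splitting sets with connected factor (`mem_finest_iff`), a description invariant under relabelling.

Attach to `H` the multiset `types H` of the degrees and classes of its factors. It determines `H` up
to relabelling, by gluing bijections between matching blocks (`exists_transport_eq_of_types_eq`),
and every multiset of connected classes with degrees summing to `n` is realised by a product on a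
disjoint union (`exists_types_eq`). A pair `(λ, (C_i))` is such a multiset sorted by degree
(`total`), which gives the bijection.

Counting pairs gives `m_n = ∑_λ ∏_i multichoose c_i a_i`, the coefficient of `x^n` in `∏_k ∑_j
multichoose c_k j x^(kj) = ∏_k (1 - x^k)^(-c_k)`. -/

namespace PermGroup

/-! ### Splitting sets and the finest partition -/

section Split

variable {X : Type*} [Fintype X] [DecidableEq X]

/-- `H` splits along `S` if every `h ∈ H` agrees on `S` with an element of `H` fixing all points
outside `S`. -/
def Splits (H : Subgroup (Equiv.Perm X)) (S : Finset X) : Prop :=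
  ∀ h ∈ H, ∃ g ∈ H, (∀ x ∈ S, g x = h x) ∧ ∀ x ∉ S, g x = x

/-- A permutation fixing all points outside `S` preserves `S`. -/
theorem apply_mem_iff_of_fixes_compl {S : Finset X} {g : Equiv.Perm X} (hg : ∀ x ∉ S, g x = x)
    (x : X) : g x ∈ S ↔ x ∈ S := by
  constructor
  · intro h
    by_contra hx
    exact hx (hg x hx ▸ h)
  · intro h
    by_contra hx
    have := g.injective (hg _ hx)
    exact hx (by rwa [this])

theorem Splits.apply_mem_iff {H : Subgroup (Equiv.Perm X)} {S : Finset X} (hS : Splits H S)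
    {h : Equiv.Perm X} (hh : h ∈ H) (x : X) : h x ∈ S ↔ x ∈ S := by
  obtain ⟨g, -, h1, h2⟩ := hS h hh
  constructor
  · intro hx
    have hy : g⁻¹ (h x) ∈ S := by
      rw [← apply_mem_iff_of_fixes_compl h2]; simpa using hx
    have h3 := h1 _ hy
    rw [← Equiv.Perm.mul_apply, mul_inv_cancel, Equiv.Perm.one_apply, h.injective.eq_iff] at h3
    rwa [← h3] at hy
  · intro hx
    rw [← h1 x hx, apply_mem_iff_of_fixes_compl h2]
    exact hx

theorem splits_univ (H : Subgroup (Equiv.Perm X)) : Splits H Finset.univ :=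
  fun h hh => ⟨h, hh, by simp, by simp⟩

/-- Dividing `h` by its part `g` on `S` leaves its part off `S`, so `g⁻¹ * h` is the witness. -/
theorem Splits.compl {H : Subgroup (Equiv.Perm X)} {S : Finset X} (hS : Splits H S) :
    Splits H Sᶜ := by
  intro h hh
  obtain ⟨g, hg, h1, h2⟩ := hS h hh
  refine ⟨g⁻¹ * h, H.mul_mem (H.inv_mem hg) hh, ?_, ?_⟩
  · intro x hx
    rw [Finset.mem_compl, ← hS.apply_mem_iff hh] at hx
    rw [Equiv.Perm.mul_apply, Equiv.Perm.inv_eq_iff_eq, h2 _ hx]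
  · intro x hx
    rw [Finset.mem_compl, not_not] at hx
    rw [Equiv.Perm.mul_apply, Equiv.Perm.inv_eq_iff_eq, h1 _ hx]

/-- Take the part on `S` first, then the part of the result on `T`. -/
theorem Splits.inter {H : Subgroup (Equiv.Perm X)} {S T : Finset X} (hS : Splits H S)
    (hT : Splits H T) : Splits H (S ∩ T) := by
  intro h hh
  obtain ⟨g, hg, h1, h2⟩ := hS h hh
  obtain ⟨k, hk, h3, h4⟩ := hT g hg
  refine ⟨k, hk, ?_, ?_⟩
  · intro x hx
    rw [Finset.mem_inter] at hx
    rw [h3 x hx.2, h1 x hx.1]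
  · intro x hx
    by_cases hx' : x ∈ T
    · rw [h3 x hx', h2]
      exact fun h => hx (Finset.mem_inter.2 ⟨h, hx'⟩)
    · exact h4 x hx'

theorem splits_inf {H : Subgroup (Equiv.Perm X)} {ι : Type*} (s : Finset ι) (f : ι → Finset X)
    (h : ∀ i ∈ s, Splits H (f i)) : Splits H (s.inf f) := by
  classical
  induction s using Finset.induction_on with
  | empty => exact splits_univ H
  | insert a s _ ih =>
    rw [Finset.inf_insert]
    exact (h a (by simp)).inter (ih fun i hi => h i (Finset.mem_insert_of_mem hi))

/-- A permutation lies in `M` as soon as all its restrictions to the blocks of a partition do. -/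
theorem mem_of_blocks_mem {M : Subgroup (Equiv.Perm X)}
    (P : Finpartition (Finset.univ : Finset X)) {h : Equiv.Perm X}
    (hP : ∀ Y ∈ P.parts, ∃ g ∈ M, (∀ x ∈ Y, g x = h x) ∧ ∀ x ∉ Y, g x = x) : h ∈ M := by
  -- The restrictions of `h` are multiplied together one block at a time.
  have key : ∀ T : Finset (Finset X), T ⊆ P.parts →
      ∃ g ∈ M, (∀ x, (∃ Y ∈ T, x ∈ Y) → g x = h x) ∧ ∀ x, (∀ Y ∈ T, x ∉ Y) → g x = x := by
    intro T
    induction T using Finset.induction_on with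
    | empty => exact fun _ => ⟨1, M.one_mem, by simp, by simp⟩
    | insert Y T hYT ih =>
      intro hT
      obtain ⟨g, hg, h1, h2⟩ := ih fun Z hZ => hT (Finset.mem_insert_of_mem hZ)
      have hY := hT (Finset.mem_insert_self Y T)
      obtain ⟨k, hk, h3, h4⟩ := hP Y hY
      have hdis : ∀ x ∈ Y, ∀ Z ∈ T, x ∉ Z := fun x hx Z hZ hxZ =>
        hYT (P.eq_of_mem_parts hY (hT (Finset.mem_insert_of_mem hZ)) hx hxZ ▸ hZ)
      refine ⟨k * g, M.mul_mem hk hg, ?_, ?_⟩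
      · intro x hx
        rw [Equiv.Perm.mul_apply]
        by_cases hxY : x ∈ Y
        · rw [h2 x (hdis x hxY), h3 x hxY]
        · obtain ⟨Z, hZ, hxZ⟩ := hx
          rw [Finset.mem_insert] at hZ
          rcases hZ with rfl | hZ
          · exact absurd hxZ hxY
          rw [h1 x ⟨Z, hZ, hxZ⟩, h4]
          intro hhx
          have hy : k⁻¹ (h x) ∈ Y := by
            rw [← apply_mem_iff_of_fixes_compl h4]; simpa using hhx
          have h5 := h3 _ hy
          rw [← Equiv.Perm.mul_apply, mul_inv_cancel, Equiv.Perm.one_apply, h.injective.eq_iff] at h5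
          exact hxY (by rwa [← h5] at hy)
      · intro x hx
        simp only [Finset.mem_insert, forall_eq_or_imp] at hx
        rw [Equiv.Perm.mul_apply, h2 x hx.2, h4 x hx.1]
  obtain ⟨g, hg, h1, -⟩ := key P.parts subset_rfl
  have : g = h := Equiv.ext fun x => h1 x (P.exists_mem (Finset.mem_univ x))
  exact this ▸ hg

/-- The subgroup of `Sym(Y)` of all permutations whose extension by the identity is in `H`. -/
def restrict (H : Subgroup (Equiv.Perm X)) (Y : Finset X) : Subgroup (Equiv.Perm Y) :=
  H.comap (Equiv.Perm.ofSubtype (p := fun x => x ∈ Y))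

theorem mem_restrict {H : Subgroup (Equiv.Perm X)} {Y : Finset X} {σ : Equiv.Perm Y} :
    σ ∈ restrict H Y ↔ Equiv.Perm.ofSubtype (p := fun x => x ∈ Y) σ ∈ H := Iff.rfl

/-- A permutation fixing all points outside `Y` is extended from a permutation of `Y`. -/
theorem exists_ofSubtype_eq {Y : Finset X} {g : Equiv.Perm X} (hg : ∀ x ∉ Y, g x = x) :
    ∃ τ : Equiv.Perm Y, Equiv.Perm.ofSubtype (p := fun x => x ∈ Y) τ = g := by
  refine ⟨g.subtypePerm (apply_mem_iff_of_fixes_compl hg), ?_⟩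
  exact Equiv.Perm.ofSubtype_subtypePerm _ fun x hx => by
    by_contra h
    exact hx (hg x h)

/-- Having a part on `Y` that lies in `H` is preserved by products and holds for the generators:
those from the block `Y` are their own part, and those from other blocks have trivial part. -/
theorem splits_of_isBlockProduct {H : Subgroup (Equiv.Perm X)}
    {P : Finpartition (Finset.univ : Finset X)} {K : ∀ Y : P.parts, Subgroup (Equiv.Perm Y.1)}
    (hK : IsBlockProduct H P K) {Y : Finset X} (hY : Y ∈ P.parts) : Splits H Y := by
  intro h hh
  have hle : ∀ Z : P.parts, (K Z).map (Equiv.Perm.ofSubtype (p := fun x => x ∈ Z.1)) ≤ H :=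
    fun Z => hK ▸ le_iSup (fun Z : P.parts =>
      (K Z).map (Equiv.Perm.ofSubtype (p := fun x => x ∈ Z.1))) Z
  suffices ∃ g ∈ H, (∀ x ∈ Y, g x = h x) ∧ (∀ x ∉ Y, g x = x) from this
  have hh' := hh
  rw [IsBlockProduct] at hK
  rw [hK] at hh'
  refine Subgroup.iSup_induction _ (C := fun h => ∃ g ∈ H, (∀ x ∈ Y, g x = h x) ∧
    (∀ x ∉ Y, g x = x)) hh' ?_ ⟨1, H.one_mem, by simp, by simp⟩ ?_
  · intro Z σ hσ
    by_cases hZ : Z.1 = Y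
    · refine ⟨σ, hle Z hσ, fun _ _ => rfl, ?_⟩
      obtain ⟨τ, -, rfl⟩ := hσ
      intro x hx
      exact Equiv.Perm.ofSubtype_apply_of_not_mem _ (by rwa [hZ])
    · refine ⟨1, H.one_mem, ?_, by simp⟩
      obtain ⟨τ, -, rfl⟩ := hσ
      intro x hx
      refine (Equiv.Perm.ofSubtype_apply_of_not_mem _ ?_).symm
      exact fun hxZ => hZ (P.eq_of_mem_parts Z.2 hY hxZ hx)
  · rintro a b ⟨g, hg, h1, h2⟩ ⟨k, hk, h3, h4⟩
    refine ⟨g * k, H.mul_mem hg hk, fun x hx => ?_, fun x hx => ?_⟩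
    · have := (apply_mem_iff_of_fixes_compl h4 x).2 hx
      rw [Equiv.Perm.mul_apply, h1 _ this, h3 x hx, Equiv.Perm.mul_apply]
    · rw [Equiv.Perm.mul_apply, h4 x hx, h2 x hx]

theorem isBlockProduct_restrict {H : Subgroup (Equiv.Perm X)}
    {P : Finpartition (Finset.univ : Finset X)} (hP : ∀ Y ∈ P.parts, Splits H Y) :
    IsBlockProduct H P fun Y => restrict H Y.1 := by
  apply le_antisymm
  · intro h hh
    refine mem_of_blocks_mem P fun Y hY => ?_
    obtain ⟨g, hg, h1, h2⟩ := hP Y hY h hh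
    refine ⟨g, ?_, h1, h2⟩
    obtain ⟨τ, rfl⟩ := exists_ofSubtype_eq h2
    exact (le_iSup (fun Z : P.parts => (restrict H Z.1).map
      (Equiv.Perm.ofSubtype (p := fun x => x ∈ Z.1))) ⟨Y, hY⟩) ⟨τ, hg, rfl⟩
  · refine iSup_le fun Y => ?_
    rintro _ ⟨τ, hτ, rfl⟩
    exact hτ

open Classical in
/-- The partition of `X` into the atoms of the Boolean algebra of sets along which `H` splits. -/
noncomputable def finest (H : Subgroup (Equiv.Perm X)) :
    Finpartition (Finset.univ : Finset X) :=
  Finpartition.atomise Finset.univ (Finset.univ.filter (Splits H))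

theorem exists_of_mem_finest {H : Subgroup (Equiv.Perm X)} {Y : Finset X}
    (hY : Y ∈ (finest H).parts) :
    ∃ Q : Finset (Finset X), ∀ x, x ∈ Y ↔ ∀ S, Splits H S → (S ∈ Q ↔ x ∈ S) := by
  classical
  rw [finest, Finpartition.mem_atomise] at hY
  obtain ⟨-, Q, -, rfl⟩ := hY
  exact ⟨Q, fun x => by simp⟩

theorem subset_or_disjoint_of_mem_finest {H : Subgroup (Equiv.Perm X)} {Y S : Finset X}
    (hY : Y ∈ (finest H).parts) (hS : Splits H S) : Y ⊆ S ∨ Disjoint Y S := by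
  obtain ⟨Q, hQ⟩ := exists_of_mem_finest hY
  by_cases h : S ∈ Q
  · exact Or.inl fun x hx => ((hQ x).1 hx S hS).1 h
  · exact Or.inr (Finset.disjoint_left.2 fun x hx hxS => h (((hQ x).1 hx S hS).2 hxS))

/-- An atom is the intersection, over all splitting sets `S`, of either `S` or its complement. -/
theorem splits_of_mem_finest {H : Subgroup (Equiv.Perm X)} {Y : Finset X}
    (hY : Y ∈ (finest H).parts) : Splits H Y := by
  classical
  obtain ⟨Q, hQ⟩ := exists_of_mem_finest hY
  have := splits_inf (H := H) (Finset.univ.filter (Splits H))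
    (fun S => if S ∈ Q then S else Sᶜ) (by
      intro S hS
      have hS' : Splits H S := by simpa using hS
      split_ifs
      · exact hS'
      · exact hS'.compl)
  convert this using 1
  ext x
  rw [hQ]
  simp only [Finset.mem_filter, Finset.mem_univ, true_and, Finset.mem_inf]
  refine forall₂_congr fun S _ => ?_
  split_ifs with h <;> simp [h]

theorem isFinestPartition_finest (H : Subgroup (Equiv.Perm X)) :
    IsFinestPartition H (finest H) := by
  refine ⟨⟨_, isBlockProduct_restrict fun Y => splits_of_mem_finest⟩, ?_⟩
  rintro Q ⟨K, hK⟩ Y hY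
  obtain ⟨x, hx⟩ := (finest H).nonempty_of_mem_parts hY
  obtain ⟨Z, hZ, hxZ⟩ := Q.exists_mem (Finset.mem_univ x)
  refine ⟨Z, hZ, ?_⟩
  rcases subset_or_disjoint_of_mem_finest hY (splits_of_isBlockProduct hK hZ) with h | h
  · exact h
  · exact absurd hxZ (Finset.disjoint_left.1 h hx)

/-- `Nonempty X` is needed because the partition of the empty set has no blocks at all. -/
theorem isConnectedSubgroup_iff {H : Subgroup (Equiv.Perm X)} :
    IsConnectedSubgroup H ↔ Nonempty X ∧ ∀ S, Splits H S → S = ∅ ∨ S = Finset.univ := by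
  constructor
  · rintro ⟨P, hP, h1⟩
    obtain rfl := hP.unique (isFinestPartition_finest H)
    have hu : Finset.univ ∈ (finest H).parts := by simp [h1]
    refine ⟨?_, fun S hS => ?_⟩
    · obtain ⟨x, -⟩ := (finest H).nonempty_of_mem_parts hu
      exact ⟨x⟩
    · rcases subset_or_disjoint_of_mem_finest hu hS with h | h
      · exact Or.inr (Finset.univ_subset_iff.1 h)
      · left
        exact Finset.eq_empty_of_forall_notMem fun x => Finset.disjoint_left.1 h (Finset.mem_univ x)
  · rintro ⟨⟨x⟩, h⟩
    refine ⟨_, isFinestPartition_finest H, ?_⟩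
    have h1 : ∀ Y ∈ (finest H).parts, Y = Finset.univ := fun Y hY =>
      (h Y (splits_of_mem_finest hY)).resolve_left ((finest H).nonempty_of_mem_parts hY).ne_empty
    refine Finset.eq_singleton_iff_unique_mem.2 ⟨?_, h1⟩
    obtain ⟨Y, hY, -⟩ := (finest H).exists_mem (Finset.mem_univ x)
    exact h1 Y hY ▸ hY

/-- Restricting to `Y` and then to `S ⊆ Y` shows that a splitting set of the factor also splits `H`,
and an atom lies inside it or is disjoint from it. -/
theorem isConnectedSubgroup_restrict {H : Subgroup (Equiv.Perm X)} {Y : Finset X}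
    (hY : Y ∈ (finest H).parts) : IsConnectedSubgroup (restrict H Y) := by
  rw [isConnectedSubgroup_iff]
  obtain ⟨x, hx⟩ := (finest H).nonempty_of_mem_parts hY
  refine ⟨⟨x, hx⟩, fun S hS => ?_⟩
  have hS' : Splits H (S.map (Function.Embedding.subtype _)) := by
    intro h hh
    obtain ⟨g, hg, h1, h2⟩ := splits_of_mem_finest hY h hh
    obtain ⟨τ, rfl⟩ := exists_ofSubtype_eq h2
    obtain ⟨σ, hσ, h3, h4⟩ := hS τ hg
    refine ⟨_, hσ, ?_, ?_⟩
    · intro x hx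
      obtain ⟨y, hy, rfl⟩ := Finset.mem_map.1 hx
      rw [Function.Embedding.subtype_apply, ← h1 _ y.2]
      rw [Equiv.Perm.ofSubtype_apply_coe, Equiv.Perm.ofSubtype_apply_coe, h3 y hy]
    · intro x hx
      by_cases hxY : x ∈ Y
      · rw [Equiv.Perm.ofSubtype_apply_of_mem _ hxY, h4]
        exact fun h => hx (Finset.mem_map.2 ⟨_, h, rfl⟩)
      · exact Equiv.Perm.ofSubtype_apply_of_not_mem _ hxY
  rcases subset_or_disjoint_of_mem_finest hY hS' with h | h
  · right
    refine Finset.eq_univ_iff_forall.2 fun y => ?_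
    obtain ⟨z, hz, hzy⟩ := Finset.mem_map.1 (h y.2)
    exact Subtype.ext hzy ▸ hz
  · left
    refine Finset.eq_empty_of_forall_notMem fun y hy => ?_
    exact Finset.disjoint_left.1 h y.2 (Finset.mem_map.2 ⟨y, hy, rfl⟩)

/-- The blocks of the finest partition are the sets along which `H` splits with connected
factor. -/
theorem mem_finest_iff {H : Subgroup (Equiv.Perm X)} {Y : Finset X} :
    Y ∈ (finest H).parts ↔ Splits H Y ∧ IsConnectedSubgroup (restrict H Y) := by
  refine ⟨fun h => ⟨splits_of_mem_finest h, isConnectedSubgroup_restrict h⟩, ?_⟩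
  rintro ⟨hY, hc⟩
  rw [isConnectedSubgroup_iff] at hc
  obtain ⟨⟨⟨x, hx⟩⟩, hc⟩ := hc
  obtain ⟨Z, hZ, hxZ⟩ := (finest H).exists_mem (Finset.mem_univ x)
  have hZY : Z ⊆ Y := (subset_or_disjoint_of_mem_finest hZ hY).resolve_right fun h =>
    Finset.disjoint_left.1 h hxZ hx
  -- The atom `Z ⊆ Y` through `x` also splits the factor on `Y`, so connectedness forces `Z = Y`.
  have hS : Splits (restrict H Y) (Finset.univ.filter fun y : Y => y.1 ∈ Z) := by
    intro τ hτ
    obtain ⟨g, hg, h1, h2⟩ := splits_of_mem_finest hZ _ hτ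
    obtain ⟨σ, rfl⟩ := exists_ofSubtype_eq (Y := Y) (g := g) fun x hx => h2 x fun h => hx (hZY h)
    refine ⟨σ, hg, fun y hy => ?_, fun y hy => ?_⟩
    · have := h1 y (by simpa using hy)
      rw [Equiv.Perm.ofSubtype_apply_coe, Equiv.Perm.ofSubtype_apply_coe] at this
      exact Subtype.ext this
    · have := h2 y (by simpa using hy)
      rw [Equiv.Perm.ofSubtype_apply_coe] at this
      exact Subtype.ext this
  rcases hc _ hS with h | h
  · have hm : (⟨x, hx⟩ : Y) ∈ Finset.univ.filter fun y : Y => y.1 ∈ Z := by simpa using hxZ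
    rw [h] at hm
    exact absurd hm (Finset.notMem_empty _)
  · have : Y ⊆ Z := fun y hy =>
      (Finset.mem_filter.1 (Finset.eq_univ_iff_forall.1 h ⟨y, hy⟩)).2
    exact hZY.antisymm this ▸ hZ

end Split

/-! ### Relabelling of points and the multiset of factors -/

section Transport

variable {X Y Z : Type*}

/-- The subgroup of `Sym(Y)` corresponding to `H ≤ Sym(X)` under a bijection `X ≃ Y`. -/
def transport (e : X ≃ Y) (H : Subgroup (Equiv.Perm X)) : Subgroup (Equiv.Perm Y) :=
  H.map e.permCongrHom.toMonoidHom

theorem mem_transport {e : X ≃ Y} {H : Subgroup (Equiv.Perm X)} {σ : Equiv.Perm Y} :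
    σ ∈ transport e H ↔ e.symm.permCongr σ ∈ H := by
  constructor
  · rintro ⟨τ, hτ, rfl⟩
    convert! hτ
    ext x
    simp
  · intro h
    refine ⟨_, h, ?_⟩
    ext x
    simp

theorem transport_trans (e : X ≃ Y) (f : Y ≃ Z) (H : Subgroup (Equiv.Perm X)) :
    transport f (transport e H) = transport (e.trans f) H := by
  ext σ
  rw [mem_transport, mem_transport, mem_transport]
  rfl

theorem transport_refl (H : Subgroup (Equiv.Perm X)) : transport (Equiv.refl X) H = H := by
  ext σ
  rw [mem_transport]
  rfl

theorem transport_eq_iff {e : X ≃ Y} {H : Subgroup (Equiv.Perm X)} {K : Subgroup (Equiv.Perm Y)} :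
    transport e H = K ↔ H = transport e.symm K := by
  constructor
  · rintro rfl
    rw [transport_trans, Equiv.self_trans_symm, transport_refl]
  · rintro rfl
    rw [transport_trans, Equiv.symm_trans_self, transport_refl]

theorem subgroupConjClass_eq_iff {n : ℕ} {H K : Subgroup (Equiv.Perm (Fin n))} :
    subgroupConjClass H = subgroupConjClass K ↔ ∃ e : Fin n ≃ Fin n, transport e H = K := by
  have key : ∀ e : Equiv.Perm (Fin n), ConjAct.toConjAct e • H = transport e H := by
    intro e
    ext σ
    rw [Subgroup.mem_pointwise_smul_iff_inv_smul_mem, mem_transport]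
    have : (ConjAct.toConjAct e)⁻¹ • σ = Equiv.permCongr (Equiv.symm e) σ := by
      rw [← ConjAct.toConjAct_inv, ConjAct.toConjAct_smul]
      ext x
      simp [Equiv.Perm.inv_def]
    rw [this]
  rw [eq_comm]
  refine Quotient.eq.trans ?_
  rw [MulAction.orbitRel_apply]
  constructor
  · rintro ⟨g, hg⟩
    exact ⟨ConjAct.ofConjAct g, (key _).symm.trans hg⟩
  · rintro ⟨e, he⟩
    exact ⟨ConjAct.toConjAct e, (key e).trans he⟩

/-- The degree of a permutation group together with its class of subgroups of the symmetric group
of that degree. -/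
noncomputable def isoClass [Fintype X] (K : Subgroup (Equiv.Perm X)) :
    Σ i, SubgroupConjClass i :=
  ⟨Fintype.card X, classOn rfl K⟩

theorem isoClass_eq_mk_iff [Fintype X] {K : Subgroup (Equiv.Perm X)} {i : ℕ}
    {c : SubgroupConjClass i} :
    isoClass K = ⟨i, c⟩ ↔ ∃ e : X ≃ Fin i, subgroupConjClass (transport e K) = c := by
  constructor
  · intro h
    cases h
    exact ⟨Fintype.equivFinOfCardEq rfl, rfl⟩
  · rintro ⟨e, rfl⟩
    obtain rfl : Fintype.card X = i := by simpa using Fintype.card_congr e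
    exact congrArg (Sigma.mk _) (classOn_eq rfl K e)

/-- After numbering both sets this is conjugacy in a symmetric group, so factors on different blocks
can be compared without casts between degrees. -/
theorem isoClass_eq_iff [Fintype X] [Fintype Y] {K : Subgroup (Equiv.Perm X)}
    {L : Subgroup (Equiv.Perm Y)} :
    isoClass K = isoClass L ↔ ∃ e : X ≃ Y, transport e K = L := by
  obtain ⟨f, hf⟩ := isoClass_eq_mk_iff.1 (rfl : isoClass L = ⟨_, classOn rfl L⟩)
  rw [show isoClass L = ⟨_, classOn rfl L⟩ from rfl, isoClass_eq_mk_iff, ← hf]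
  constructor
  · rintro ⟨e, he⟩
    obtain ⟨g, hg⟩ := subgroupConjClass_eq_iff.1 he
    refine ⟨(e.trans g).trans f.symm, ?_⟩
    rw [← transport_trans, ← transport_trans, hg, eq_comm]
    exact transport_eq_iff.1 rfl
  · rintro ⟨e, rfl⟩
    exact ⟨e.trans f, by rw [← transport_trans]⟩

theorem isoClass_fin {n : ℕ} (K : Subgroup (Equiv.Perm (Fin n))) :
    isoClass K = ⟨n, subgroupConjClass K⟩ :=
  isoClass_eq_mk_iff.2 ⟨Equiv.refl _, by rw [transport_refl]⟩

theorem isoClass_transport [Fintype X] [Fintype Y] (e : X ≃ Y) (K : Subgroup (Equiv.Perm X)) :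
    isoClass (transport e K) = isoClass K :=
  (isoClass_eq_iff.2 ⟨e, rfl⟩).symm

variable [Fintype X] [DecidableEq X] [Fintype Y] [DecidableEq Y]

theorem Splits.transport {H : Subgroup (Equiv.Perm X)} {S : Finset X} (hS : Splits H S)
    (e : X ≃ Y) : Splits (transport e H) (S.map e.toEmbedding) := by
  intro σ hσ
  rw [mem_transport] at hσ
  obtain ⟨g, hg, h1, h2⟩ := hS _ hσ
  refine ⟨e.permCongr g, ⟨g, hg, rfl⟩, fun y hy => ?_, fun y hy => ?_⟩
  · obtain ⟨x, hx, rfl⟩ := Finset.mem_map.1 hy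
    simp [h1 x hx]
  · rw [Finset.mem_map_equiv] at hy
    simp [h2 _ hy]

theorem isConnectedSubgroup_transport {H : Subgroup (Equiv.Perm X)} (hH : IsConnectedSubgroup H)
    (e : X ≃ Y) : IsConnectedSubgroup (transport e H) := by
  rw [isConnectedSubgroup_iff] at hH ⊢
  refine ⟨hH.1.map e, fun S hS => ?_⟩
  have h := hS.transport e.symm
  rw [← transport_eq_iff.1 (rfl : PermGroup.transport e H = _)] at h
  rcases hH.2 _ h with h | h
  · exact Or.inl (Finset.map_eq_empty.1 h)
  · right
    refine Finset.eq_univ_iff_forall.2 fun y => ?_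
    have := Finset.eq_univ_iff_forall.1 h (e.symm y)
    rw [Finset.mem_map_equiv] at this
    simpa using this

theorem restrict_transport (H : Subgroup (Equiv.Perm X)) (e : X ≃ Y) {S : Finset X}
    {T : Finset Y} (h : ∀ x, x ∈ S ↔ e x ∈ T) :
    restrict (transport e H) T = transport (e.subtypeEquiv h) (restrict H S) := by
  ext σ
  rw [mem_transport, mem_restrict, mem_restrict, mem_transport]
  have : e.symm.permCongr (Equiv.Perm.ofSubtype (p := fun y => y ∈ T) σ) =
      Equiv.Perm.ofSubtype (p := fun x => x ∈ S) ((e.subtypeEquiv h).symm.permCongr σ) := by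
    ext x
    by_cases hx : x ∈ S
    · rw [Equiv.Perm.ofSubtype_apply_of_mem _ hx, Equiv.permCongr_apply, Equiv.symm_symm,
        Equiv.Perm.ofSubtype_apply_of_mem _ ((h x).1 hx)]
      rfl
    · rw [Equiv.Perm.ofSubtype_apply_of_not_mem _ hx, Equiv.permCongr_apply, Equiv.symm_symm,
        Equiv.Perm.ofSubtype_apply_of_not_mem _ (mt (h x).2 hx), Equiv.symm_apply_apply]
  rw [this]

/-- Both conditions in `mem_finest_iff` are invariant under bijections. -/
theorem map_mem_finest_transport {H : Subgroup (Equiv.Perm X)} (e : X ≃ Y) {S : Finset X}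
    (hS : S ∈ (finest H).parts) : S.map e.toEmbedding ∈ (finest (transport e H)).parts := by
  rw [mem_finest_iff] at hS ⊢
  refine ⟨hS.1.transport e, ?_⟩
  rw [restrict_transport (S := S) _ _ (by simp)]
  exact isConnectedSubgroup_transport hS.2 _

theorem finest_transport_parts (H : Subgroup (Equiv.Perm X)) (e : X ≃ Y) :
    (finest (transport e H)).parts = (finest H).parts.map e.finsetCongr.toEmbedding := by
  ext T
  rw [Finset.mem_map_equiv]
  constructor
  · intro hT
    have := map_mem_finest_transport e.symm hT
    rwa [← transport_eq_iff.1 (rfl : transport e H = _)] at this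
  · intro hT
    have := map_mem_finest_transport e hT
    rwa [← Equiv.finsetCongr_apply, Equiv.apply_symm_apply] at this

/-- The multiset of isomorphism types of the factors of `H` along its finest partition. -/
noncomputable def types (H : Subgroup (Equiv.Perm X)) : Multiset (Σ i, SubgroupConjClass i) :=
  (finest H).parts.val.map fun S => isoClass (restrict H S)

theorem types_transport (H : Subgroup (Equiv.Perm X)) (e : X ≃ Y) :
    types (transport e H) = types H := by
  rw [types, finest_transport_parts, Finset.map_val, Multiset.map_map]
  refine Multiset.map_congr rfl fun S _ => ?_
  rw [Function.comp_apply, restrict_transport (S := S) _ _ (by simp), isoClass_transport]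

theorem map_fst_types (H : Subgroup (Equiv.Perm X)) :
    (types H).map Sigma.fst = (finest H).parts.val.map Finset.card := by
  rw [types, Multiset.map_map]
  refine Multiset.map_congr rfl fun S _ => ?_
  simp [isoClass]

theorem mem_iff_forall_finest {H : Subgroup (Equiv.Perm X)} {σ : Equiv.Perm X} :
    σ ∈ H ↔ ∀ S ∈ (finest H).parts, ∃ τ ∈ restrict H S, ∀ x : S, σ x = τ x := by
  constructor
  · intro hσ S hS
    obtain ⟨g, hg, h1, h2⟩ := splits_of_mem_finest hS σ hσ
    obtain ⟨τ, rfl⟩ := exists_ofSubtype_eq h2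
    refine ⟨τ, hg, fun x => ?_⟩
    rw [← h1 x x.2, Equiv.Perm.ofSubtype_apply_coe]
  · intro h
    refine mem_of_blocks_mem (finest H) fun S hS => ?_
    obtain ⟨τ, hτ, h1⟩ := h S hS
    refine ⟨_, hτ, fun x hx => ?_, fun x hx => ?_⟩
    · rw [h1 ⟨x, hx⟩, Equiv.Perm.ofSubtype_apply_of_mem _ hx]
    · exact Equiv.Perm.ofSubtype_apply_of_not_mem _ hx

/-- Multiplicities are fibre sizes, so the fibres over each value are in bijection, and these
bijections are assembled. -/
theorem exists_equiv_of_map_univ_eq {ι κ α : Type*} [Fintype ι] [Fintype κ] {f : ι → α}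
    {g : κ → α} (h : Finset.univ.val.map f = Finset.univ.val.map g) :
    ∃ e : ι ≃ κ, ∀ i, g (e i) = f i := by
  classical
  have hc : ∀ a, Nonempty ({i // f i = a} ≃ {k // g k = a}) := by
    intro a
    rw [← Fintype.card_eq, Fintype.card_subtype, Fintype.card_subtype]
    have := congrArg (Multiset.count a) h
    rw [Multiset.count_map, Multiset.count_map] at this
    simpa [Finset.card, eq_comm] using this
  let E := fun a => (hc a).some
  refine ⟨(Equiv.sigmaFiberEquiv f).symm.trans ((Equiv.sigmaCongrRight E).trans
    (Equiv.sigmaFiberEquiv g)), fun i => ?_⟩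
  exact (E (f i) ⟨i, rfl⟩).2

/-- Permutation groups with the same multiset of factors are isomorphic. -/
theorem exists_transport_eq_of_types_eq {H : Subgroup (Equiv.Perm X)}
    {K : Subgroup (Equiv.Perm Y)} (h : types H = types K) : ∃ e : X ≃ Y, transport e H = K := by
  have h' : (Finset.univ : Finset (finest H).parts).val.map
        (fun S => isoClass (restrict H S.1)) =
      (Finset.univ : Finset (finest K).parts).val.map (fun S => isoClass (restrict K S.1)) := by
    exact (Multiset.attach_map_val' _ _).trans (h.trans (Multiset.attach_map_val' _ _).symm)
  obtain ⟨φ, hφ⟩ := exists_equiv_of_map_univ_eq h'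
  -- `φ` matches blocks of equal type and `E S` carries the factor on `S` to the one on `φ S`; `e`
  -- below is the union of the `E S`.
  choose E hE using fun S => isoClass_eq_iff.1 (hφ S).symm
  let u : X ≃ Σ S : (finest H).parts, S.1 :=
    (Equiv.subtypeUnivEquiv fun x => Finset.mem_univ x).symm.trans (finest H).equivSigmaParts
  let v : Y ≃ Σ S : (finest K).parts, S.1 :=
    (Equiv.subtypeUnivEquiv fun x => Finset.mem_univ x).symm.trans (finest K).equivSigmaParts
  let e : X ≃ Y := u.trans ((Equiv.sigmaCongr φ E).trans v.symm)
  have he : ∀ (S : (finest H).parts) (x : S.1), e x = E S x := by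
    intro S x
    have hu : u x = ⟨S, x⟩ := by
      rw [← Equiv.eq_symm_apply]
      rfl
    change v.symm (Equiv.sigmaCongr φ E (u x)) = E S x
    rw [hu]
    rfl
  refine ⟨e, ?_⟩
  ext σ
  rw [mem_transport, mem_iff_forall_finest, mem_iff_forall_finest]
  have hstep : ∀ S : (finest H).parts,
      (∃ τ ∈ restrict H S.1, ∀ x : S.1, e.symm.permCongr σ x = τ x) ↔
      ∃ τ ∈ restrict K (φ S).1, ∀ x : (φ S).1, σ x = τ x := by
    intro S
    rw [← hE S]
    constructor
    · rintro ⟨τ, hτ, h1⟩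
      refine ⟨(E S).permCongr τ, ⟨τ, hτ, rfl⟩, fun x => ?_⟩
      have := h1 ((E S).symm x)
      rw [Equiv.permCongr_apply, Equiv.symm_symm, Equiv.symm_apply_eq, he, he,
        Equiv.apply_symm_apply] at this
      rw [this, Equiv.permCongr_apply]
    · rintro ⟨τ, hτ, h1⟩
      refine ⟨_, mem_transport.1 hτ, fun x => ?_⟩
      rw [Equiv.permCongr_apply, Equiv.symm_symm, Equiv.symm_apply_eq, he, he, h1,
        Equiv.permCongr_apply, Equiv.symm_symm, Equiv.apply_symm_apply]
  constructor
  · intro h1 T hT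
    have := (hstep (φ.symm ⟨T, hT⟩)).1 (h1 _ (φ.symm ⟨T, hT⟩).2)
    rwa [Equiv.apply_symm_apply] at this
  · intro h1 S hS
    exact (hstep ⟨S, hS⟩).2 (h1 _ (φ ⟨S, hS⟩).2)

end Transport

/-! ### Products of permutation groups on disjoint unions -/

section Product

variable {ι : Type*} {F : ι → Type*}

/-- The direct product of permutation groups, acting on the disjoint union. -/
def sigmaProduct (K : ∀ j, Subgroup (Equiv.Perm (F j))) : Subgroup (Equiv.Perm (Σ j, F j)) :=
  (Subgroup.pi Set.univ K).map (Equiv.Perm.sigmaCongrRightHom F)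

theorem mem_sigmaProduct {K : ∀ j, Subgroup (Equiv.Perm (F j))} {σ : Equiv.Perm (Σ j, F j)} :
    σ ∈ sigmaProduct K ↔
      ∃ τ : ∀ j, Equiv.Perm (F j), (∀ j, τ j ∈ K j) ∧ ∀ j x, σ ⟨j, x⟩ = ⟨j, τ j x⟩ := by
  constructor
  · rintro ⟨τ, hτ, rfl⟩
    exact ⟨τ, fun j => hτ j trivial, fun j x => rfl⟩
  · rintro ⟨τ, hτ, h⟩
    exact ⟨τ, fun j _ => hτ j, Equiv.ext fun x => (h x.1 x.2).symm⟩

/-- A summand of a disjoint union, as a subset. -/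
def sigmaBlock (F : ι → Type*) [∀ j, Fintype (F j)] (j : ι) : Finset (Σ j, F j) :=
  Finset.univ.map (Function.Embedding.sigmaMk j)

theorem mem_sigmaBlock [∀ j, Fintype (F j)] {j : ι} {x : Σ j, F j} : x ∈ sigmaBlock F j ↔ x.1 = j := by
  rw [sigmaBlock, Finset.mem_map]
  constructor
  · rintro ⟨y, -, rfl⟩
    rfl
  · rintro rfl
    exact ⟨x.2, Finset.mem_univ _, rfl⟩

/-- A summand of a disjoint union is in bijection with the corresponding subset. -/
noncomputable def equivSigmaBlock (F : ι → Type*) [∀ j, Fintype (F j)] (j : ι) :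
    F j ≃ sigmaBlock F j :=
  Equiv.ofBijective (fun x => ⟨⟨j, x⟩, mem_sigmaBlock.2 rfl⟩) (by
    constructor
    · intro x y h
      simpa using h
    · rintro ⟨⟨i, x⟩, h⟩
      obtain rfl : i = j := mem_sigmaBlock.1 h
      exact ⟨x, rfl⟩)

theorem equivSigmaBlock_apply [∀ j, Fintype (F j)] (j : ι) (x : F j) :
    (equivSigmaBlock F j x : Σ j, F j) = ⟨j, x⟩ := rfl

variable [Fintype ι] [DecidableEq ι] [∀ j, Fintype (F j)] [∀ j, DecidableEq (F j)]

theorem splits_sigmaBlock (K : ∀ j, Subgroup (Equiv.Perm (F j))) (j : ι) :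
    Splits (sigmaProduct K) (sigmaBlock F j) := by
  intro σ hσ
  obtain ⟨τ, hτ, h⟩ := mem_sigmaProduct.1 hσ
  refine ⟨Equiv.Perm.sigmaCongrRightHom F fun i => if i = j then τ i else 1,
    mem_sigmaProduct.2 ⟨fun i => if i = j then τ i else 1, fun i => ?_, fun i x => rfl⟩, ?_, ?_⟩
  · dsimp only
    split_ifs
    · exact hτ i
    · exact one_mem _
  · rintro ⟨i, x⟩ hx
    have hx : i = j := mem_sigmaBlock.1 hx
    rw [h]
    simp [hx]
  · rintro ⟨i, x⟩ hx
    have hx : i ≠ j := fun h => hx (mem_sigmaBlock.2 h)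
    simp [hx]

theorem restrict_sigmaProduct (K : ∀ j, Subgroup (Equiv.Perm (F j))) (j : ι) :
    restrict (sigmaProduct K) (sigmaBlock F j) = transport (equivSigmaBlock F j) (K j) := by
  ext σ
  rw [mem_transport, mem_restrict, mem_sigmaProduct]
  constructor
  · rintro ⟨τ, hτ, h⟩
    convert! hτ j
    ext x
    rw [Equiv.permCongr_apply, Equiv.symm_symm, Equiv.symm_apply_eq]
    apply Subtype.ext
    rw [equivSigmaBlock_apply, ← h, ← equivSigmaBlock_apply, Equiv.Perm.ofSubtype_apply_coe]
  · intro hσ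
    refine ⟨Function.update 1 j ((equivSigmaBlock F j).symm.permCongr σ), fun i => ?_,
      fun i x => ?_⟩
    · by_cases hi : i = j
      · subst hi
        simpa using hσ
      · simp only [Function.update_of_ne hi, Pi.one_apply]
        exact one_mem _
    · by_cases hi : i = j
      · subst hi
        rw [Function.update_self, ← equivSigmaBlock_apply, ← equivSigmaBlock_apply,
          Equiv.Perm.ofSubtype_apply_coe, Equiv.permCongr_apply, Equiv.symm_symm,
          Equiv.apply_symm_apply]
      · rw [Function.update_of_ne hi, Equiv.Perm.ofSubtype_apply_of_not_mem]
        · rfl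
        · exact fun h => hi (mem_sigmaBlock.1 h)

/-- Each summand splits with connected factor, hence is a block of the finest partition; the
summands cover everything, so there are no other blocks. -/
theorem types_sigmaProduct {K : ∀ j, Subgroup (Equiv.Perm (F j))}
    (hK : ∀ j, IsConnectedSubgroup (K j)) :
    types (sigmaProduct K) = (Finset.univ : Finset ι).val.map fun j => isoClass (K j) := by
  -- Empty summands would all give the same subset; connectedness excludes them.
  have hne : ∀ j, Nonempty (F j) := fun j => (isConnectedSubgroup_iff.1 (hK j)).1
  have hinj : Function.Injective (sigmaBlock F) := by
    intro i j h
    obtain ⟨x⟩ := hne i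
    have : (⟨i, x⟩ : Σ j, F j) ∈ sigmaBlock F j := h ▸ mem_sigmaBlock.2 rfl
    exact mem_sigmaBlock.1 this
  have hmem : ∀ j, sigmaBlock F j ∈ (finest (sigmaProduct K)).parts := by
    intro j
    rw [mem_finest_iff, restrict_sigmaProduct]
    exact ⟨splits_sigmaBlock K j, isConnectedSubgroup_transport (hK j) _⟩
  have hparts : (finest (sigmaProduct K)).parts = Finset.univ.map ⟨sigmaBlock F, hinj⟩ := by
    ext S
    rw [Finset.mem_map]
    constructor
    · intro hS
      obtain ⟨x, hx⟩ := (finest _).nonempty_of_mem_parts hS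
      exact ⟨x.1, Finset.mem_univ _,
        (finest _).eq_of_mem_parts (hmem x.1) hS (mem_sigmaBlock.2 rfl) hx⟩
    · rintro ⟨j, -, rfl⟩
      exact hmem j
  rw [types, hparts, Finset.map_val, Multiset.map_map]
  refine Multiset.map_congr rfl fun j _ => ?_
  rw [Function.comp_apply, Function.Embedding.coeFn_mk, restrict_sigmaProduct, isoClass_transport]

end Product

/-- A class of subgroups of a symmetric group is connected if it has a connected member. -/
def IsConnectedClass (t : Σ i, SubgroupConjClass i) : Prop :=
  ∃ H, IsConnectedSubgroup H ∧ subgroupConjClass H = t.2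

theorem isConnectedClass_isoClass {X : Type*} [Fintype X] [DecidableEq X]
    {K : Subgroup (Equiv.Perm X)} (hK : IsConnectedSubgroup K) : IsConnectedClass (isoClass K) := by
  obtain ⟨f, hf⟩ := isoClass_eq_mk_iff.1 (rfl : isoClass K = ⟨_, classOn rfl K⟩)
  exact ⟨_, isConnectedSubgroup_transport hK f, hf⟩

theorem isConnectedClass_of_mem_types {X : Type*} [Fintype X] [DecidableEq X]
    {H : Subgroup (Equiv.Perm X)} {t : Σ i, SubgroupConjClass i} (ht : t ∈ types H) :
    IsConnectedClass t := by
  obtain ⟨S, hS, rfl⟩ := Multiset.mem_map.1 ht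
  exact isConnectedClass_isoClass (isConnectedSubgroup_restrict hS)

theorem sum_map_fst_types {X : Type*} [Fintype X] [DecidableEq X]
    (H : Subgroup (Equiv.Perm X)) : ((types H).map Sigma.fst).sum = Fintype.card X := by
  rw [map_fst_types]
  exact (finest H).sum_card_parts

theorem IsConnectedClass.pos {t : Σ i, SubgroupConjClass i} (ht : IsConnectedClass t) :
    0 < t.1 := by
  obtain ⟨H, hH, -⟩ := ht
  obtain ⟨x⟩ := (isConnectedSubgroup_iff.1 hH).1
  exact x.pos

theorem exists_types_eq {n : ℕ} {s : Multiset (Σ i, SubgroupConjClass i)}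
    (hs : ∀ t ∈ s, IsConnectedClass t) (hn : (s.map Sigma.fst).sum = n) :
    ∃ H : Subgroup (Equiv.Perm (Fin n)), types H = s := by
  induction s using Quotient.inductionOn with
  | _ l =>
  -- Indexing by positions in a list gives repeated classes separate summands.
  choose K hK hKl using fun j : Fin l.length => hs (l.get j) (by simp)
  have htypes : types (sigmaProduct K) = (l : Multiset (Σ i, SubgroupConjClass i)) := by
    rw [types_sigmaProduct hK, Fin.univ_val_map]
    congr 1
    conv_rhs => rw [← List.ofFn_get l]
    congr 1
    funext j
    rw [isoClass_fin, hKl]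
  have hcard : Fintype.card (Σ j : Fin l.length, Fin (l.get j).1) = n := by
    rw [← sum_map_fst_types (sigmaProduct K), htypes]
    exact hn
  exact ⟨transport (Fintype.equivFinOfCardEq hcard) (sigmaProduct K), by
    rw [types_transport, htypes]; rfl⟩

/-! ### Pairs as multisets of connected classes -/

section Pairs

variable {n : ℕ}

/-- The multiset of all connected classes occurring in a pair `(λ, (C_1, …, C_n))`. -/
noncomputable def total (A : PartitionPair n) : Multiset (Σ i, SubgroupConjClass i) :=
  ∑ i : Finset.Icc 1 n, ((A.classes i).1.map Subtype.val).map (Sigma.mk (i : ℕ))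

theorem filter_sum_map_mk {ι : Type*} [Fintype ι] {κ : Type*} [DecidableEq κ] {α : κ → Type*}
    {f : ι → κ} (hf : Function.Injective f) (s : ∀ i, Multiset (α (f i))) (i : ι) :
    (∑ j, (s j).map (Sigma.mk (f j))).filter (fun t => t.1 = f i) = (s i).map (Sigma.mk (f i)) := by
  classical
  let φ : Multiset (Σ k, α k) →+ Multiset (Σ k, α k) :=
    { toFun := Multiset.filter fun t => t.1 = f i
      map_zero' := Multiset.filter_zero _
      map_add' := Multiset.filter_add _ }
  change φ _ = _
  rw [map_sum, Finset.sum_eq_single i]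
  · refine Multiset.filter_eq_self.2 ?_
    intro t ht
    obtain ⟨c, -, rfl⟩ := Multiset.mem_map.1 ht
    rfl
  · intro j _ hj
    refine Multiset.filter_eq_nil.2 ?_
    intro t ht
    obtain ⟨c, -, rfl⟩ := Multiset.mem_map.1 ht
    exact fun h => hj (hf h)
  · simp

theorem filter_total (A : PartitionPair n) (i : Finset.Icc 1 n) :
    (total A).filter (fun t => t.1 = (i : ℕ)) =
      ((A.classes i).1.map Subtype.val).map (Sigma.mk (i : ℕ)) :=
  filter_sum_map_mk (f := fun i : Finset.Icc 1 n => (i : ℕ)) Subtype.val_injective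
    (fun i => (A.classes i).1.map Subtype.val) i

theorem one_le_and_le_of_mem_parts (p : n.Partition) {i : ℕ} (hi : i ∈ p.parts) :
    i ∈ Finset.Icc 1 n :=
  Finset.mem_Icc.2 ⟨p.parts_pos hi, (Multiset.le_sum_of_mem hi).trans_eq p.parts_sum⟩

theorem map_fst_total (A : PartitionPair n) : (total A).map Sigma.fst = A.shape.parts := by
  have h1 : (total A).map Sigma.fst =
      ∑ i : Finset.Icc 1 n, Multiset.replicate (A.shape.parts.count (i : ℕ)) (i : ℕ) := by
    rw [total, ← Multiset.coe_mapAddMonoidHom, map_sum]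
    refine Finset.sum_congr rfl fun i _ => ?_
    rw [Multiset.coe_mapAddMonoidHom, Multiset.map_map, Multiset.map_map]
    refine Multiset.eq_replicate.2 ⟨?_, ?_⟩
    · rw [Multiset.card_map]
      exact (A.classes i).2
    · intro b hb
      obtain ⟨c, -, rfl⟩ := Multiset.mem_map.1 hb
      rfl
  rw [h1]
  ext i
  rw [Multiset.count_sum']
  simp only [Multiset.count_replicate]
  by_cases hi : i ∈ Finset.Icc 1 n
  · rw [Finset.sum_eq_single ⟨i, hi⟩]
    · simp
    · intro j _ hj
      rw [if_neg]
      exact fun h => hj (Subtype.ext h)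
    · simp
  · rw [Multiset.count_eq_zero_of_notMem (mt (one_le_and_le_of_mem_parts _) hi)]
    refine Finset.sum_eq_zero fun j _ => ?_
    rw [if_neg]
    rintro rfl
    exact hi j.2

theorem isConnectedClass_of_mem_total {A : PartitionPair n} {t : Σ i, SubgroupConjClass i}
    (ht : t ∈ total A) : IsConnectedClass t := by
  rw [total, Multiset.mem_sum] at ht
  obtain ⟨i, -, ht⟩ := ht
  obtain ⟨c, hc, rfl⟩ := Multiset.mem_map.1 ht
  obtain ⟨d, -, rfl⟩ := Multiset.mem_map.1 hc
  exact d.2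

/-- The degrees with multiplicity recover `λ`, and the members of degree `i` recover `C_i`. -/
theorem total_injective : Function.Injective (total (n := n)) := by
  intro A B h
  have hshape : A.shape = B.shape := by
    apply Nat.Partition.ext
    rw [← map_fst_total, ← map_fst_total, h]
  have hclasses : ∀ i, (A.classes i).1 = (B.classes i).1 := by
    intro i
    apply Multiset.map_injective Subtype.val_injective
    apply Multiset.map_injective (sigma_mk_injective (i := (i : ℕ)))
    rw [← filter_total, ← filter_total, h]
  obtain ⟨p, C⟩ := A
  obtain ⟨q, D⟩ := B
  obtain rfl : p = q := hshape
  obtain rfl : C = D := funext fun i => Subtype.ext (hclasses i)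
  rfl

/-- The elements of a multiset of a sigma type which lie in a given summand. -/
def fiber {κ : Type*} [DecidableEq κ] {α : κ → Type*} (s : Multiset (Σ i, α i)) (i : κ) :
    Multiset (α i) :=
  s.filterMap fun t => if h : t.1 = i then some (h ▸ t.2) else none

theorem map_mk_fiber {κ : Type*} [DecidableEq κ] {α : κ → Type*} (s : Multiset (Σ i, α i))
    (i : κ) : (fiber s i).map (Sigma.mk i) = s.filter (fun t => t.1 = i) := by
  induction s using Multiset.induction_on with
  | empty => rfl
  | cons t s ih =>
    rw [fiber] at ih ⊢
    by_cases h : t.1 = i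
    · obtain ⟨j, t⟩ := t
      obtain rfl : j = i := h
      rw [Multiset.filterMap_cons_some _ _ _ (dif_pos rfl), Multiset.map_cons, ih,
        Multiset.filter_cons_of_pos (p := fun t : Σ k, α k => t.1 = j) _ rfl]
    · rw [Multiset.filterMap_cons_none _ _ (dif_neg h), ih,
        Multiset.filter_cons_of_neg (p := fun t : Σ k, α k => t.1 = i) _ h]

theorem card_fiber {κ : Type*} [DecidableEq κ] {α : κ → Type*} (s : Multiset (Σ i, α i))
    (i : κ) : (fiber s i).card = (s.map Sigma.fst).count i := by
  rw [← Multiset.card_map (Sigma.mk i), map_mk_fiber, Multiset.count_map]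
  simp only [eq_comm]

theorem sum_map_mk_fiber {κ : Type*} [DecidableEq κ] {α : κ → Type*} (s : Multiset (Σ i, α i))
    (I : Finset κ) (hs : ∀ t ∈ s, t.1 ∈ I) : ∑ i : I, (fiber s i).map (Sigma.mk i.1) = s := by
  classical
  ext t
  rw [Multiset.count_sum']
  simp only [map_mk_fiber, Multiset.count_filter]
  by_cases ht : t ∈ s
  · rw [Finset.sum_eq_single ⟨t.1, hs t ht⟩]
    · simp
    · intro j _ hj
      rw [if_neg]
      exact fun h => hj (Subtype.ext h.symm)
    · simp
  · simp [Multiset.count_eq_zero_of_notMem ht]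

theorem exists_total_eq {s : Multiset (Σ i, SubgroupConjClass i)}
    (hs : ∀ t ∈ s, IsConnectedClass t) (hn : (s.map Sigma.fst).sum = n) :
    ∃ A : PartitionPair n, total A = s := by
  -- Each member is bundled with its connectedness, so that the fibres consist of elements of
  -- `ConnectedClass i`.
  obtain ⟨u, rfl⟩ : ∃ u : Multiset (Σ i, ConnectedClass i),
      u.map (Sigma.map id fun _ => Subtype.val) = s := by
    refine ⟨s.pmap (fun t ht => ⟨t.1, t.2, ht⟩) hs, ?_⟩
    rw [Multiset.map_pmap]
    exact (Multiset.pmap_eq_map _ _ _ hs).trans (Multiset.map_id s)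
  have hfst : (u.map (Sigma.map id fun _ => Subtype.val)).map Sigma.fst = u.map Sigma.fst := by
    rw [Multiset.map_map]
    rfl
  let p : n.Partition :=
    { parts := u.map Sigma.fst
      parts_pos := by
        intro i hi
        rw [← hfst] at hi
        obtain ⟨t, ht, rfl⟩ := Multiset.mem_map.1 hi
        exact (hs t ht).pos
      parts_sum := by rw [← hfst, hn] }
  refine ⟨⟨p, fun i => ⟨fiber u i, card_fiber u i⟩⟩, ?_⟩
  conv_rhs => rw [← sum_map_mk_fiber u (Finset.Icc 1 n) fun t ht =>
    one_le_and_le_of_mem_parts p (Multiset.mem_map_of_mem _ ht)]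
  rw [← Multiset.coe_mapAddMonoidHom, map_sum]
  refine Finset.sum_congr rfl fun i _ => ?_
  rw [Multiset.coe_mapAddMonoidHom, Multiset.map_map, Multiset.map_map]
  rfl

theorem map_mk_factorClasses {X : Type*} [Fintype X] [DecidableEq X]
    (H : Subgroup (Equiv.Perm X)) (i : ℕ) :
    (factorClasses (finest H) (fun Y => restrict H Y.1) i).map (Sigma.mk i) =
      (types H).filter (fun t => t.1 = i) := by
  have h1 : types H = (Finset.univ : Finset (finest H).parts).val.map
      (fun S => isoClass (restrict H S.1)) := (Multiset.attach_map_val' _ _).symm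
  rw [h1, Multiset.filter_map, factorClasses, Multiset.map_map]
  have h2 : ((Finset.univ : Finset (finest H).parts).val.filter
      ((fun t => t.1 = i) ∘ fun S => isoClass (restrict H S.1))) =
      (Finset.univ : Finset {Y : (finest H).parts // Fintype.card Y.1 = i}).val.map
        Subtype.val := by
    have := Finset.subtype_map (s := (Finset.univ : Finset (finest H).parts))
      (fun Y => Fintype.card Y.1 = i)
    rw [Finset.subtype_univ] at this
    exact (congrArg Finset.val this).symm
  rw [h2, Multiset.map_map]
  refine Multiset.map_congr rfl ?_
  rintro ⟨Y, rfl⟩ _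
  rfl

theorem exists_total_eq_types (H : Subgroup (Equiv.Perm (Fin n))) :
    ∃ A : PartitionPair n, total A = types H :=
  exists_total_eq (fun _ => isConnectedClass_of_mem_types)
    ((sum_map_fst_types H).trans (Fintype.card_fin n))

theorem sum_map_fst_total (A : PartitionPair n) : ((total A).map Sigma.fst).sum = n := by
  rw [map_fst_total, A.shape.parts_sum]

/-- Conjugacy classes of subgroups of `S_n` correspond to pairs `(λ, (C_1, …, C_n))` by
decomposing a subgroup along its finest partition. -/
theorem exists_equiv_partitionPair (n : ℕ) : ∃ Φ : SubgroupConjClass n ≃ PartitionPair n,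
    ∀ H : Subgroup (Equiv.Perm (Fin n)), total (Φ (subgroupConjClass H)) = types H := by
  choose A hA using fun H : Subgroup (Equiv.Perm (Fin n)) => exists_total_eq_types H
  let Φ : SubgroupConjClass n → PartitionPair n := Quotient.lift A (by
    intro H K hHK
    obtain ⟨e, rfl⟩ := subgroupConjClass_eq_iff.1 (Quotient.sound hHK :
      subgroupConjClass H = subgroupConjClass K)
    apply total_injective
    rw [hA, hA, types_transport])
  have hΦ : ∀ H, total (Φ (subgroupConjClass H)) = types H := hA
  refine ⟨Equiv.ofBijective Φ ⟨?_, ?_⟩, hΦ⟩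
  · intro c d
    induction c using Quotient.inductionOn with
    | _ H =>
    induction d using Quotient.inductionOn with
    | _ K =>
    intro h
    refine subgroupConjClass_eq_iff.2 (exists_transport_eq_of_types_eq ?_)
    rw [← hΦ, ← hΦ]
    exact congrArg total h
  · intro B
    obtain ⟨H, hH⟩ := exists_types_eq (fun _ => isConnectedClass_of_mem_total)
      (sum_map_fst_total B)
    exact ⟨subgroupConjClass H, total_injective ((hΦ H).trans hH)⟩

end Pairs

/-! ### The Euler transform -/

section Euler

open PowerSeries

variable {R : Type*} [CommRing R]

theorem mk_one_pow_eq_mk_multichoose (d : ℕ) :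
    (mk 1 : R⟦X⟧) ^ d = mk fun j => (Nat.multichoose d j : R) := by
  cases d with
  | zero =>
    ext j
    cases j <;> simp [coeff_one]
  | succ d =>
    rw [mk_one_pow_eq_mk_choose_add]
    ext j
    rw [coeff_mk, coeff_mk, Nat.multichoose_eq]
    congr 1
    rw [show d + 1 + j - 1 = d + j by omega, Nat.choose_symm_add]

theorem invOfUnit_one_sub_X_pow {k : ℕ} (hk : k ≠ 0) :
    invOfUnit (1 - X ^ k : R⟦X⟧) 1 = expand k hk (mk 1) := by
  have h1 : (1 - X ^ k : R⟦X⟧) * invOfUnit (1 - X ^ k) 1 = 1 := mul_invOfUnit _ _ (by simp [hk])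
  have h2 : expand k hk (mk 1) * (1 - X ^ k : R⟦X⟧) = 1 := by
    have := congrArg (expand k hk) (mk_one_mul_one_sub_eq_one R)
    simpa using this
  exact (left_inv_eq_right_inv h2 h1).symm

open scoped PowerSeries.WithPiTopology in
-- The `d`-th power of the geometric series in `X ^ k` counts multisets drawn from `d` kinds. The
-- constant term is split off to match the factors of `Nat.Partition.hasProd_genFun`.
theorem invOfUnit_pow_eq {k : ℕ} (hk : k ≠ 0) [TopologicalSpace R] [T2Space R] (d : ℕ) :
    (invOfUnit (1 - X ^ k : R⟦X⟧) 1) ^ d =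
      1 + ∑' j, (Nat.multichoose d (j + 1) : R) • X ^ (k * (j + 1)) := by
  have hsum := Nat.Partition.summable_genFun_term' (fun _ j => (Nat.multichoose d j : R)) hk
  rw [invOfUnit_one_sub_X_pow hk, ← map_pow, mk_one_pow_eq_mk_multichoose]
  ext m
  rw [map_add, hsum.map_tsum _ (WithPiTopology.continuous_coeff _ _), coeff_expand, coeff_mk]
  simp only [map_smul, coeff_X_pow, coeff_one, smul_eq_mul, mul_ite, mul_one, mul_zero]
  by_cases hd : k ∣ m
  · obtain ⟨q, rfl⟩ := hd
    rw [if_pos (dvd_mul_right k q), Nat.mul_div_cancel_left _ (Nat.pos_of_ne_zero hk)]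
    cases q with
    | zero => simp [hk]
    | succ q =>
      rw [tsum_eq_single q]
      · simp [hk]
      · intro j hj
        rw [if_neg]
        intro h
        have := Nat.eq_of_mul_eq_mul_left (Nat.pos_of_ne_zero hk) h
        omega
  · rw [if_neg hd, if_neg (by rintro rfl; exact hd (dvd_zero k))]
    rw [tsum_congr (g := fun _ => (0 : R)), tsum_zero, add_zero]
    intro j
    rw [if_neg]
    rintro rfl
    exact hd (dvd_mul_right _ _)

/-- A pair is a partition together with a family of multisets. -/
def partitionPairEquivSigma (n : ℕ) : PartitionPair n ≃
    Σ p : n.Partition, ∀ i : Finset.Icc 1 n, Sym (ConnectedClass i) (p.parts.count (i : ℕ)) where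
  toFun A := ⟨A.shape, A.classes⟩
  invFun B := ⟨B.1, B.2⟩
  left_inv _ := rfl
  right_inv _ := rfl

theorem card_partitionPair (n : ℕ) : Nat.card (PartitionPair n) =
    ∑ p : n.Partition, p.parts.toFinsupp.prod
      fun i j => Nat.multichoose (Nat.card (ConnectedClass i)) j := by
  classical
  rw [Nat.card_congr (partitionPairEquivSigma n), Nat.card_sigma]
  refine Finset.sum_congr rfl fun p _ => ?_
  rw [Nat.card_pi]
  simp only [Sym.natCard_sym_eq_multichoose]
  rw [Finset.prod_coe_sort (Finset.Icc 1 n)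
    (fun i => Nat.multichoose (Nat.card (ConnectedClass i)) (p.parts.count i))]
  rw [Finsupp.prod, Multiset.toFinsupp_support]
  symm
  simp only [Multiset.toFinsupp_apply]
  -- Sizes `i` absent from `p` contribute the factor `multichoose _ 0 = 1`.
  refine Finset.prod_subset (fun i hi => one_le_and_le_of_mem_parts p (by simpa using hi)) ?_
  intro i _ hi
  rw [Multiset.count_eq_zero_of_notMem (by simpa using hi), Nat.multichoose_zero_right]

open scoped PowerSeries.WithPiTopology in
theorem isEulerTransform_card : IsEulerTransform (fun n => Nat.card (SubgroupConjClass n))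
    (fun k => Nat.card (ConnectedClass k)) := by
  have h := Nat.Partition.hasProd_genFun (R := ℤ)
    (fun i j => (Nat.multichoose (Nat.card (ConnectedClass i)) j : ℤ))
  have hcard : ∀ n, Nat.card (SubgroupConjClass n) = Nat.card (PartitionPair n) := fun n =>
    Nat.card_congr (exists_equiv_partitionPair n).choose
  have hgen : Nat.Partition.genFun
      (fun i j => (Nat.multichoose (Nat.card (ConnectedClass i)) j : ℤ)) =
      1 + PowerSeries.mk fun n =>
        if n = 0 then 0 else (Nat.card (SubgroupConjClass n) : ℤ) := by
    ext n
    rw [Nat.Partition.coeff_genFun, map_add, coeff_mk, coeff_one]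
    have : (Nat.card (SubgroupConjClass n) : ℤ) = ∑ p : n.Partition, p.parts.toFinsupp.prod
        fun i j => (Nat.multichoose (Nat.card (ConnectedClass i)) j : ℤ) := by
      rw [hcard, card_partitionPair]
      push_cast [Finsupp.prod]
      rfl
    rw [← this]
    rcases eq_or_ne n 0 with rfl | hn
    -- The group `S_0` has a single class of subgroups, matching the constant term `1`.
    · simp
    · simp [hn]
  rw [hgen, funext fun i => (invOfUnit_pow_eq (R := ℤ) (Nat.succ_ne_zero i) _).symm] at h
  -- The product in `h` runs over `i : ℕ` with `k = i + 1`, hence the reindexing.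
  rw [IsEulerTransform, ← Equiv.pnatEquivNat.symm.hasProd_iff]
  exact h

end Euler

end PermGroup

theorem mainTheorem2 :
    (∀ n : ℕ, ∃ Φ : SubgroupConjClass n ≃ PartitionPair n,
      ∀ H : Subgroup (Equiv.Perm (Fin n)),
        ∃ (P : Finpartition (Finset.univ : Finset (Fin n)))
          (K : ∀ Y : P.parts, Subgroup (Equiv.Perm Y.1)),
          IsFinestPartition H P ∧ IsBlockProduct H P K ∧
          (∀ Y, IsConnectedSubgroup (K Y)) ∧
          (Φ (subgroupConjClass H)).shape.parts = P.parts.val.map Finset.card ∧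
          ∀ i : Finset.Icc 1 n,
            ((Φ (subgroupConjClass H)).classes i).1.map Subtype.val = factorClasses P K i) ∧
    IsEulerTransform (fun n => Nat.card (SubgroupConjClass n))
      (fun k => Nat.card (ConnectedClass k)) := by
  refine ⟨fun n => ?_, PermGroup.isEulerTransform_card⟩
  obtain ⟨Φ, hΦ⟩ := PermGroup.exists_equiv_partitionPair n
  refine ⟨Φ, fun H => ⟨PermGroup.finest H, fun Y => PermGroup.restrict H Y.1,
    PermGroup.isFinestPartition_finest H,
    PermGroup.isBlockProduct_restrict fun _ => PermGroup.splits_of_mem_finest,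
    fun Y => PermGroup.isConnectedSubgroup_restrict Y.2, ?_, fun i => ?_⟩⟩
  · rw [← PermGroup.map_fst_total, hΦ, PermGroup.map_fst_types]
  -- The comparison is made inside the sigma type, where both sides are the degree-`i` part of
  -- `types H`.
  · apply Multiset.map_injective (sigma_mk_injective (i := (i : ℕ)))
    rw [← PermGroup.filter_total, hΦ, PermGroup.map_mk_factorClasses]
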